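/- Let $g:\mathbb C\to\mathbb C$ be either a polynomial of degree at least $2$ or a transcendental entire function (an entire function with an essential singularity at $\infty$), and let $N=\mathrm{Id}-g/g'$ be its Newton map, regarded as a meromorphic map $N:\mathbb C\to\widehat{\mathbb C}$ (rational or transcendental), with removable singularities of $g/g'$ removed. Let $\zeta\in\mathbb C$ be an attracting fixed point of $N$, that is, $N(\zeta)=\zeta$ and $|N'(\zeta)|<1$. Let $U$ be the immediate basin of attraction of $\zeta$, that is, the connected component containing $\zeta$ of the set of all $z\in\mathbb C$ whose iterates $N^n(z)$ are finite for all $n\ge 0$ and converge to $\zeta$ as $n\to\infty$. Then $U$ is an unbounded subset of $\mathbb C$. -/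

import Mathlib

open Filter Topology

/-- A transcendental entire function: holomorphic on the plane, with an essential singularity
at infinity (that is, `w ↦ g (1 / w)` does not extend meromorphically to `0`). -/
def IsTranscendentalEntire (g : ℂ → ℂ) : Prop :=
  Differentiable ℂ g ∧ ¬ MeromorphicAt (fun w : ℂ => g w⁻¹) 0

/-- The functions to which the method is applied: polynomials of degree at least two and
transcendental entire functions. -/
def IsNewtonInput (g : ℂ → ℂ) : Prop :=
  (∃ p : Polynomial ℂ, 2 ≤ p.natDegree ∧ ∀ z, g z = p.eval z) ∨ IsTranscendentalEntire g

open Classical in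
/-- The Newton map `N = id - g / g'` as a meromorphic function from the plane to the Riemann
sphere (for `g` entire and not constant). The quotient `g / g'` has a removable singularity with
value `0` at each zero of `g`, simple or multiple, so `N z = z` there. Where `g' z = 0` and
`g z ≠ 0`, the function `N` has a pole. -/
noncomputable def sphereNewtonMap (g : ℂ → ℂ) (z : ℂ) : OnePoint ℂ :=
  if g z = 0 then (z : OnePoint ℂ)
  else if deriv g z = 0 then OnePoint.infty
  else ((z - g z / deriv g z : ℂ) : OnePoint ℂ)

/-- `ζ` is a finite attracting (possibly superattracting) fixed point of `f`: near `ζ` the map `f`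
is given by a holomorphic function `h` that fixes `ζ` and has derivative of modulus less than `1`
there. -/
def IsAttractingFixedPoint (f : ℂ → OnePoint ℂ) (ζ : ℂ) : Prop :=
  ∃ h : ℂ → ℂ, AnalyticAt ℂ h ζ ∧ (∀ᶠ z in 𝓝 ζ, f z = (h z : OnePoint ℂ)) ∧
    h ζ = ζ ∧ ‖deriv h ζ‖ < 1

/-- The basin of attraction of `ζ`: the points `z` all of whose iterates `u n = fⁿ(z)` are finite
and converge to `ζ`. A point whose orbit meets a pole is not in the basin. -/
def attractingBasin (f : ℂ → OnePoint ℂ) (ζ : ℂ) : Set ℂ :=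
  {z | ∃ u : ℕ → ℂ, u 0 = z ∧ (∀ n, f (u n) = (u (n + 1) : OnePoint ℂ)) ∧
    Tendsto u atTop (𝓝 ζ)}

/-- The immediate basin of attraction of `ζ`: the connected component of the basin of attraction
that contains `ζ`. -/
def immediateBasin (f : ℂ → OnePoint ℂ) (ζ : ℂ) : Set ℂ :=
  connectedComponentIn (attractingBasin f ζ) ζ

/-! Suppose U is bounded. Since N maps U into itself, |g| ≤ 2M|g'| on U and hence on its closure, so
the closure contains no pole. Thus N is analytic there, and it sends no boundary point into U,
because U is a component of a backward invariant basin.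

Such a map must fix a boundary point (`exists_fixedPoint_mem_closure_diff`). N is onto U, and it is
a covering over V, the set U minus ζ and the critical orbits. Join a point of V to one of its
preimages by a polynomial curve in V and lift it repeatedly (`exists_holomorphic_lift`), each lift
starting where the last one ended. A polynomial extends holomorphically to a neighbourhood of [0,1],
so the lifts are holomorphic inverse branches, and their derivatives tend to 0
(`eventually_norm_deriv_inverse_branch_lt`). The curves shrink, and a limit point of their endpoints
is fixed and lies outside U.

That point is a root of g, so it has an open basin of its own (`newtonMap_at_zero`), which meets U.
An orbit in the overlap would have two limits. -/

/-! ### Curves in planar domains -/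

open Metric Set in
/-- In an open connected planar set, two points outside a countable set can be joined off it. -/
theorem IsPreconnected.joinedIn_diff_countable {U P : Set ℂ} (hU : IsOpen U)
    (hc : IsPreconnected U) (hP : P.Countable) {x y : ℂ} (hx : x ∈ U \ P) (hy : y ∈ U \ P) :
    JoinedIn (U \ P) x y := by
  have ball_joined : ∀ c r, 0 < r → ball c r ⊆ U → ∀ a ∈ ball c r \ P, ∀ b ∈ ball c r \ P,
      JoinedIn (U \ P) a b := by
    intro c r hr hsub a ha b hb
    -- The disc is homeomorphic to the plane, where the complement of a countable set is path
    -- connected.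
    let e : OpenPartialHomeomorph ℂ ℂ := OpenPartialHomeomorph.univBall c r
    have es : e.source = univ := OpenPartialHomeomorph.univBall_source c r
    have et : e.target = ball c r := OpenPartialHomeomorph.univBall_target c hr
    have hinj : Function.Injective e := by
      intro u v huv
      exact e.injOn (by simp [es]) (by simp [es]) huv
    have hcount : (e ⁻¹' P).Countable := hP.preimage hinj
    have hpc : IsPathConnected (e ⁻¹' P)ᶜ :=
      hcount.isPathConnected_compl_of_one_lt_rank (by simp [Complex.rank_real_complex])
    have himg : IsPathConnected (e '' (e ⁻¹' P)ᶜ) :=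
      hpc.image (OpenPartialHomeomorph.continuous_univBall c r)
    have hmem : ∀ z ∈ ball c r \ P, z ∈ e '' (e ⁻¹' P)ᶜ := by
      intro z hz
      have hz' : z ∈ e.target := et ▸ hz.1
      refine ⟨e.symm z, ?_, e.right_inv hz'⟩
      simpa [e.right_inv hz'] using hz.2
    refine (himg.joinedIn a (hmem a ha) b (hmem b hb)).mono ?_
    rintro _ ⟨z, hz, rfl⟩
    exact ⟨hsub (et ▸ e.map_source (by simp [es])), hz⟩
  have dense : ∀ c r, 0 < r → ∃ a, a ∈ ball c r \ P := fun c r hr => by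
    obtain ⟨a, ha, hb⟩ := (hP.dense_compl ℝ).inter_open_nonempty (ball c r) isOpen_ball
      ⟨c, mem_ball_self hr⟩
    exact ⟨a, ha, hb⟩
  -- The induction runs through all points of U, including those of P, so the relation concerns
  -- nearby points off P.
  let R : ℂ → ℂ → Prop := fun x y => ∃ r > 0, ∀ a ∈ ball x r \ P, ∀ b ∈ ball y r \ P,
    JoinedIn (U \ P) a b
  have key : R x y := by
    refine hc.induction₂ R ?_ ?_ ?_ hx.1 hy.1
    · intro x hx
      obtain ⟨r, hr, hb⟩ := Metric.isOpen_iff.1 hU x hx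
      refine mem_nhdsWithin_of_mem_nhds ?_
      filter_upwards [ball_mem_nhds x (half_pos hr)] with y hy
      refine ⟨r / 2, half_pos hr, fun a ha b hb' => ball_joined x r hr hb a
        ⟨ball_subset_ball (by linarith) ha.1, ha.2⟩ b ⟨?_, hb'.2⟩⟩
      have h1 := mem_ball.1 hb'.1
      have h2 := mem_ball.1 hy
      exact mem_ball.2 (by linarith [dist_triangle b y x])
    · rintro x y z - - - ⟨r, hr, h⟩ ⟨s, hs, h'⟩
      obtain ⟨b, hb⟩ := dense y (min r s) (lt_min hr hs)
      refine ⟨min r s, lt_min hr hs, fun a ha c hc => (h a ?_ b ?_).trans (h' b ?_ c ?_)⟩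
      · exact ⟨ball_subset_ball (min_le_left _ _) ha.1, ha.2⟩
      · exact ⟨ball_subset_ball (min_le_left _ _) hb.1, hb.2⟩
      · exact ⟨ball_subset_ball (min_le_right _ _) hb.1, hb.2⟩
      · exact ⟨ball_subset_ball (min_le_right _ _) hc.1, hc.2⟩
    · rintro x y - - ⟨r, hr, h⟩
      exact ⟨r, hr, fun a ha b hb => (h b hb a ha).symm⟩
  obtain ⟨r, hr, h⟩ := key
  exact h x ⟨mem_ball_self hr, hx.2⟩ y ⟨mem_ball_self hr, hy.2⟩

open Metric Set in
/-- Two points joined by a path in an open planar set are joined by a polynomial curve in it. -/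
theorem JoinedIn.exists_polynomial {V : Set ℂ} (hV : IsOpen V) {x y : ℂ} (h : JoinedIn V x y) :
    ∃ p : Polynomial ℂ, p.eval 0 = x ∧ p.eval 1 = y ∧
      ∀ t ∈ Icc (0 : ℝ) 1, p.eval (t : ℂ) ∈ V := by
  obtain ⟨γ, hγ⟩ := h
  obtain ⟨δ, hδ, hsub⟩ := (isCompact_range γ.continuous).exists_thickening_subset_open hV
    (range_subset_iff.2 hγ)
  let γ' : ℝ → ℂ := γ.extend
  have hc : Continuous γ' := γ.continuous_extend
  have h0 : γ' 0 = x := γ.extend_zero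
  have h1 : γ' 1 = y := γ.extend_one
  obtain ⟨a, ha⟩ := exists_polynomial_near_of_continuousOn 0 1 (fun t => (γ' t).re)
    (by fun_prop) (δ / 8) (by positivity)
  obtain ⟨b, hb⟩ := exists_polynomial_near_of_continuousOn 0 1 (fun t => (γ' t).im)
    (by fun_prop) (δ / 8) (by positivity)
  let q : Polynomial ℂ := a.map (algebraMap ℝ ℂ) + Polynomial.C Complex.I * b.map (algebraMap ℝ ℂ)
  have hq : ∀ t ∈ Icc (0 : ℝ) 1, ‖q.eval (t : ℂ) - γ' t‖ < δ / 4 := by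
    intro t ht
    have e1 : (a.map (algebraMap ℝ ℂ)).eval (t : ℂ) = ((a.eval t : ℝ) : ℂ) :=
      (Polynomial.eval_map _ _).trans (Polynomial.eval₂_at_apply (algebraMap ℝ ℂ) t)
    have e2 : (b.map (algebraMap ℝ ℂ)).eval (t : ℂ) = ((b.eval t : ℝ) : ℂ) :=
      (Polynomial.eval_map _ _).trans (Polynomial.eval₂_at_apply (algebraMap ℝ ℂ) t)
    refine (Complex.norm_le_abs_re_add_abs_im _).trans_lt ?_
    have h1 := ha t ht
    have h2 := hb t ht
    simp only [q, Polynomial.eval_add, Polynomial.eval_mul, Polynomial.eval_C, e1, e2]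
    simp
    linarith
  -- A linear correction restores the endpoints; it costs less than δ/4.
  let p : Polynomial ℂ := q + Polynomial.C (x - q.eval 0) * (1 - Polynomial.X)
    + Polynomial.C (y - q.eval 1) * Polynomial.X
  refine ⟨p, by simp [p], by simp [p], fun t ht => hsub (mem_thickening_iff.2 ⟨γ' t, ?_, ?_⟩)⟩
  · exact ⟨projIcc 0 1 zero_le_one t, rfl⟩
  have b0 : ‖x - q.eval 0‖ < δ / 4 := by
    have := hq 0 (by simp)
    rw [h0, norm_sub_rev] at this
    simpa using this
  have b1 : ‖y - q.eval 1‖ < δ / 4 := by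
    have := hq 1 (by simp)
    rw [h1, norm_sub_rev] at this
    simpa using this
  have e : p.eval (t : ℂ) - γ' t = (q.eval (t : ℂ) - γ' t) + (x - q.eval 0) * ((1 - t : ℝ) : ℂ)
      + (y - q.eval 1) * (t : ℂ) := by
    simp [p]; ring
  rw [dist_eq_norm, e]
  refine (norm_add₃_le).trans_lt ?_
  rw [norm_mul, norm_mul, Complex.norm_real, Complex.norm_real, Real.norm_of_nonneg ht.1,
    Real.norm_of_nonneg (sub_nonneg.2 ht.2)]
  have := hq t ht
  nlinarith [ht.1, ht.2, norm_nonneg (x - q.eval 0), norm_nonneg (y - q.eval 1)]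

/-! ### Holomorphic lifts and covered discs -/

/-- A continuous lift of a differentiable function through a holomorphic map with nonvanishing
derivative is differentiable. -/
theorem DifferentiableAt.of_comp_of_deriv_ne_zero {f φ : ℂ → ℂ} {s : ℂ}
    (hf : AnalyticAt ℂ f (φ s)) (hd : deriv f (φ s) ≠ 0) (hφ : ContinuousAt φ s)
    {ψ : ℂ → ℂ} (hψ : DifferentiableAt ℂ ψ s) (h : ∀ᶠ z in 𝓝 s, f (φ z) = ψ z) :
    DifferentiableAt ℂ φ s := by
  have hs := hf.hasStrictDerivAt
  have h1 := hs.eventually_left_inverse hd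
  have h2 : ∀ᶠ z in 𝓝 s, hs.localInverse f _ _ hd (ψ z) = φ z := by
    filter_upwards [hφ.eventually h1, h] with z hz hz'
    rw [← hz', hz]
  have h3 : DifferentiableAt ℂ (fun z => hs.localInverse f _ _ hd (ψ z)) s := by
    have h4 := (hs.to_localInverse hd).hasDerivAt.differentiableAt
    rw [h.self_of_nhds] at h4
    exact h4.comp s hψ
  exact h3.congr_of_eventuallyEq (h2.mono fun _ hz => hz.symm)

open Metric Set in
/-- A bounded holomorphic function on a disc whose derivative at the center is bounded below covers
a disc of definite radius. -/
theorem exists_ball_subset_image_of_le_norm_deriv {δ M ε : ℝ} (hδ : 0 < δ) (hM : 0 < M)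
    (hε : 0 < ε) :
    ∃ ρ > 0, ∀ (h : ℂ → ℂ) (s : ℂ), DifferentiableOn ℂ h (ball s δ) →
      (∀ z ∈ ball s δ, ‖h z‖ ≤ M) → ε ≤ ‖deriv h s‖ → ball (h s) ρ ⊆ h '' ball s δ := by
  -- The Schwarz lemma, applied twice, bounds the slope of `h` at `s` by 2M/δ and the slope of that
  -- slope by C. So on the circle of radius r the slope stays within ε/2 of the derivative.
  let C : ℝ := 2 * (2 * M / δ) / δ
  have hC : 0 < C := by positivity
  let r : ℝ := min (δ / 2) (ε / (2 * C))
  have hr : 0 < r := by positivity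
  have hrδ : r < δ := (min_le_left _ _).trans_lt (by linarith)
  have hrC : r * C ≤ ε / 2 := by
    calc r * C ≤ ε / (2 * C) * C := by gcongr; exact min_le_right _ _
      _ = ε / 2 := by field_simp
  refine ⟨r * (ε / 2) / 2, by positivity, fun h s hd hb he => ?_⟩
  have hs : s ∈ ball s δ := mem_ball_self hδ
  have hn : ball s δ ∈ 𝓝 s := ball_mem_nhds s hδ
  let d := dslope h s
  have dd : DifferentiableOn ℂ d (ball s δ) := (Complex.differentiableOn_dslope hn).2 hd
  have db : ∀ z ∈ ball s δ, ‖d z‖ ≤ 2 * M / δ := fun z hz =>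
    Complex.norm_dslope_le_div_of_mapsTo_ball hd (fun w hw => by
      rw [mem_closedBall, dist_eq_norm]
      linarith [norm_sub_le (h w) (h s), hb w hw, hb s hs]) hz
  have ddb : ∀ z ∈ ball s δ, ‖dslope d s z‖ ≤ C := fun z hz =>
    Complex.norm_dslope_le_div_of_mapsTo_ball dd (fun w hw => by
      rw [mem_closedBall, dist_eq_norm]
      linarith [norm_sub_le (d w) (d s), db w hw, db s hs]) hz
  have ds : d s = deriv h s := dslope_same h s
  have sph : ∀ z ∈ sphere s r, r * (ε / 2) ≤ ‖h z - h s‖ := by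
    intro z hz
    have hzr : ‖z - s‖ = r := by simpa [dist_eq_norm] using hz
    have hzb : z ∈ ball s δ := by rw [mem_ball, dist_eq_norm, hzr]; exact hrδ
    have e1 : h z - h s = (z - s) * d z := by
      have := sub_smul_dslope h s z
      rw [← this, smul_eq_mul]
    have e2 : d z - d s = (z - s) * dslope d s z := by
      have := sub_smul_dslope d s z
      rw [← this, smul_eq_mul]
    have e3 : ‖d z - d s‖ ≤ ε / 2 := by
      rw [e2, norm_mul, hzr]
      exact (mul_le_mul_of_nonneg_left (ddb z hzb) hr.le).trans hrC
    have e4 : ε / 2 ≤ ‖d z‖ := by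
      have := norm_sub_norm_le (d s) (d z)
      rw [norm_sub_rev, ds] at this
      rw [ds] at e3
      linarith
    rw [e1, norm_mul, hzr]
    gcongr
  have hcl : closedBall s r ⊆ ball s δ := closedBall_subset_ball hrδ
  have hfreq : ∃ᶠ z in 𝓝 s, h z ≠ h s := by
    intro hev
    have : h =ᶠ[𝓝 s] fun _ => h s := hev.mono fun z hz => not_not.1 hz
    rw [this.deriv_eq, deriv_const, norm_zero] at he
    linarith
  refine (DiffContOnCl.ball_subset_image_closedBall ?_ hr sph hfreq).trans (image_mono hcl)
  refine DifferentiableOn.diffContOnCl (hd.mono ?_)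
  rwa [closure_ball s hr.ne']

open Metric Set in
/-- Holomorphic lifting over convex domains through a map of a compact set that is locally biholomorphic
over the target. -/
theorem exists_holomorphic_lift {K U V S : Set ℂ} {f ψ : ℂ → ℂ} (hK : IsCompact K) (hU : IsOpen U)
    (hUK : U ⊆ K) (hf : ContinuousOn f K)
    (hV : ∀ z ∈ K, f z ∈ V → z ∈ U ∧ AnalyticAt ℂ f z ∧ deriv f z ≠ 0)
    (hS : IsOpen S) (hSc : Convex ℝ S) (hψ : DifferentiableOn ℂ ψ S) (hψV : MapsTo ψ S V)
    {a b : ℂ} (ha : a ∈ S) (hb : b ∈ K) (hab : f b = ψ a) :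
    ∃ φ : ℂ → ℂ, DifferentiableOn ℂ φ S ∧ MapsTo φ S U ∧ φ a = b ∧ ∀ s ∈ S, f (φ s) = ψ s := by
  have : CompactSpace K := isCompact_iff_compactSpace.1 hK
  have : ContractibleSpace S := hSc.contractibleSpace ⟨a, ha⟩
  have : LocallyPathConnectedSpace S := hS.locallyPathConnectedSpace
  let F : K → ℂ := K.domRestrict f
  have hval : IsLocalHomeomorphOn (Subtype.val : K → ℂ) (Subtype.val ⁻¹' U) := by
    rw [isLocalHomeomorphOn_iff_isOpenEmbedding_restrict]
    intro x hx
    refine ⟨Subtype.val ⁻¹' U, (hU.preimage continuous_subtype_val).mem_nhds hx, ?_⟩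
    refine ⟨Topology.IsEmbedding.subtypeVal.comp Topology.IsEmbedding.subtypeVal, ?_⟩
    convert hU
    ext z
    simp only [mem_range, Subtype.exists]
    constructor
    · rintro ⟨w, hw, hwU, rfl⟩
      exact hwU
    · intro hz
      exact ⟨z, hUK hz, hz, rfl⟩
  have hloc : IsLocalHomeomorphOn F (F ⁻¹' V) := by
    have hfl : IsLocalHomeomorphOn f (f ⁻¹' V ∩ K) := by
      refine IsLocalHomeomorphOn.mk _ _ fun z hz => ?_
      obtain ⟨-, han, hd⟩ := hV z hz.2 hz.1
      have hs := han.hasStrictDerivAt.hasStrictFDerivAt_equiv hd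
      exact ⟨hs.toOpenPartialHomeomorph f, hs.mem_toOpenPartialHomeomorph_source, fun _ _ => rfl⟩
    exact hfl.comp (hval.mono fun z hz => (hV z z.2 hz).1) fun z hz => ⟨hz, z.2⟩
  -- Compactness of K upgrades the local homeomorphism over V to a covering; S is contractible, so
  -- lifts exist.
  have hcov : IsCoveringMapOn F V := .of_isLocalHomeomorphOn hf.domRestrict hloc
  obtain ⟨G, ⟨hGa, hG⟩, -⟩ := hcov.existsUnique_continuousMap_lifts
    (⟨S.domRestrict ψ, hψ.continuousOn.domRestrict⟩ : C(S, ℂ)) (a₀ := ⟨a, ha⟩) (e₀ := ⟨b, hb⟩) hab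
    fun s => hψV s.2
  have hG' : ∀ s : S, f (G s) = ψ s := fun s => congrFun hG s
  classical
  let φ : ℂ → ℂ := fun s => if h : s ∈ S then G ⟨s, h⟩ else 0
  have hφ : ∀ s (h : s ∈ S), φ s = G ⟨s, h⟩ := fun s h => dif_pos h
  have hφf : ∀ s ∈ S, f (φ s) = ψ s := fun s hs => by rw [hφ s hs, hG']
  have hφK : ∀ s ∈ S, φ s ∈ K := fun s hs => by rw [hφ s hs]; exact (G ⟨s, hs⟩).2
  have hφV : ∀ s ∈ S, f (φ s) ∈ V := fun s hs => by rw [hφf s hs]; exact hψV hs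
  have hφc : ContinuousOn φ S := by
    rw [continuousOn_iff_continuous_domRestrict]
    have : S.domRestrict φ = fun s => (G s : ℂ) := funext fun s => hφ s s.2
    rw [this]
    exact continuous_subtype_val.comp G.continuous
  refine ⟨φ, fun s hs => ?_, fun s hs => (hV _ (hφK s hs) (hφV s hs)).1, ?_, hφf⟩
  · obtain ⟨-, han, hd⟩ := hV _ (hφK s hs) (hφV s hs)
    have hn := hS.mem_nhds hs
    exact (DifferentiableAt.of_comp_of_deriv_ne_zero han hd (hφc.continuousAt hn)
      (hψ.differentiableAt hn) (mem_of_superset hn hφf)).differentiableWithinAt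
  · rw [hφ a ha, hGa]

/-! ### Contraction of inverse branches -/

open Metric Set in
/-- If the iterates converge to `ζ` locally uniformly on `U`, then points whose `n`-th iterates stay
away from `ζ` leave every compact part of `U`. -/
theorem exists_ball_eventually_notMem_of_iterate {U K : Set ℂ} {f : ℂ → ℂ} {ζ : ℂ} (hU : IsOpen U)
    (hconv : TendstoLocallyUniformlyOn (fun n => f^[n]) (fun _ => ζ) atTop U) (hK : IsClosed K)
    (hζ : ζ ∉ K) {w : ℂ} (hw : w ∈ U) :
    ∃ ρ > 0, ∀ᶠ n in atTop, ∀ v ∈ ball w ρ, f^[n] v ∉ K := by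
  obtain ⟨ε, hε, hsub⟩ := Metric.isOpen_iff.1 hK.isOpen_compl ζ hζ
  obtain ⟨t, ht, hev⟩ := Metric.tendstoLocallyUniformlyOn_iff.1 hconv ε hε w hw
  rw [hU.nhdsWithin_eq hw] at ht
  obtain ⟨ρ, hρ, hρt⟩ := Metric.mem_nhds_iff.1 ht
  refine ⟨ρ, hρ, hev.mono fun n hn v hv => hsub ?_⟩
  rw [mem_ball, dist_comm]
  exact hn v (hρt hv)

open Metric Set in
/-- Inverse branches of the iterates of a map attracted to `ζ` contract uniformly on compact sets. -/
theorem eventually_norm_deriv_inverse_branch_lt {U S K : Set ℂ} {f : ℂ → ℂ} {ζ : ℂ}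
    {Φ : ℕ → ℂ → ℂ} (hU : IsOpen U) (hbdd : Bornology.IsBounded U)
    (hconv : TendstoLocallyUniformlyOn (fun n => f^[n]) (fun _ => ζ) atTop U)
    {δ : ℝ} (hδ : 0 < δ) (hK : IsCompact K) (hKS : ∀ s ∈ K, ball s δ ⊆ S)
    (hd : ∀ n, DifferentiableOn ℂ (Φ n) S) (hm : ∀ n, MapsTo (Φ n) S U)
    (hinv : ∀ n, ∀ s ∈ S, f^[n] (Φ n s) = Φ 0 s) (hζ : ζ ∉ Φ 0 '' K) {ε : ℝ} (hε : 0 < ε) :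
    ∀ᶠ n in atTop, ∀ s ∈ K, ‖deriv (Φ n) s‖ < ε := by
  have hKS' : K ⊆ S := fun s hs => hKS s hs (mem_ball_self hδ)
  obtain ⟨M, hM, hUM⟩ := hbdd.exists_pos_norm_le
  obtain ⟨ρ, hρ, hball⟩ := exists_ball_subset_image_of_le_norm_deriv hδ hM hε
  by_contra hcon
  simp only [not_eventually, not_forall, not_lt] at hcon
  obtain ⟨k, hk, hP⟩ := extraction_of_frequently_atTop hcon
  choose s hsK hs using hP
  have hxU : ∀ n, Φ (k n) (s n) ∈ U := fun n => hm _ (hKS' (hsK n))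
  obtain ⟨w, -, l, hl, hlim⟩ := hbdd.isCompact_closure.tendsto_subseq
    (x := fun n => Φ (k n) (s n)) fun n => subset_closure (hxU n)
  -- A disc of fixed radius about each of these points lies in U, so their limit w is in U and not
  -- on the boundary. Near w the iterates tend uniformly to ζ, yet these points return to `Φ 0 ''
  -- K`.
  have hbU : ∀ n, ball (Φ (k n) (s n)) ρ ⊆ U := fun n =>
    (hball (Φ (k n)) (s n) ((hd _).mono (hKS _ (hsK n)))
      (fun z hz => hUM _ (hm _ (hKS _ (hsK n) hz))) (hs n)).trans
      (image_subset_iff.2 fun z hz => hm _ (hKS _ (hsK n) hz))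
  have hwU : w ∈ U := by
    obtain ⟨n, hn⟩ := (hlim.eventually (ball_mem_nhds w hρ)).exists
    exact hbU (l n) (by rw [mem_ball, dist_comm]; exact hn)
  have hKcl : IsClosed (Φ 0 '' K) := (hK.image_of_continuousOn ((hd 0).continuousOn.mono hKS')).isClosed
  obtain ⟨r, hr, hev⟩ := exists_ball_eventually_notMem_of_iterate hU hconv hKcl hζ hwU
  have h2 := (hk.comp hl).tendsto_atTop.eventually hev
  obtain ⟨n, hn, hn'⟩ := ((hlim.eventually (ball_mem_nhds w hr)).and h2).exists
  refine hn' _ hn ?_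
  simp only [Function.comp_apply]
  rw [hinv _ _ (hKS' (hsK _))]
  exact mem_image_of_mem _ (hsK _)

/-! ### A fixed point on the boundary -/

open Metric Set in
/-- A nonconstant holomorphic self-map of a bounded domain that is holomorphic on the closure and
maps the boundary off the domain is surjective. -/
theorem image_eq_of_forall_mem_closure {U : Set ℂ} {f : ℂ → ℂ} (hU : IsOpen U)
    (hc : IsPreconnected U) (hne : U.Nonempty) (hbdd : Bornology.IsBounded U)
    (hf : AnalyticOnNhd ℂ f (closure U))
    (hmaps : MapsTo f U U) (hbd : ∀ z ∈ closure U, f z ∈ U → z ∈ U)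
    (hnc : ¬ ∃ w, ∀ z ∈ U, f z = w) : f '' U = U := by
  refine hmaps.image_subset.antisymm ?_
  have ho : IsOpen (f '' U) :=
    (((hf.mono subset_closure).is_constant_or_isOpen hc).resolve_left hnc) U Subset.rfl hU
  have hcl : IsClosed (f '' closure U) :=
    (hbdd.isCompact_closure.image_of_continuousOn hf.continuousOn).isClosed
  -- By `hbd`, f(U) is the trace on U of the compact set f(closure U), hence relatively closed as
  -- well as open.
  refine (hc.subset_left_of_subset_union ho hcl.isOpen_compl ?_ ?_ ?_)
  · rw [disjoint_compl_right_iff_subset]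
    exact image_mono subset_closure
  · intro z hz
    by_cases h : z ∈ f '' closure U
    · obtain ⟨w, hw, rfl⟩ := h
      exact Or.inl ⟨w, hbd w hw hz, rfl⟩
    · exact Or.inr h
  · obtain ⟨z, hz⟩ := hne
    exact ⟨f z, hmaps hz, z, hz, rfl⟩

-- Infinitely many critical points would accumulate in the compact closure, where the identity
-- theorem still applies to f'. Finiteness keeps the postcritical set closed.
open Metric Set in
theorem finite_setOf_deriv_eq_zero {U : Set ℂ} {f : ℂ → ℂ} (hU : IsOpen U)
    (hc : IsPreconnected U) (hbdd : Bornology.IsBounded U) (hf : AnalyticOnNhd ℂ f (closure U))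
    (hnc : ¬ ∃ w, ∀ z ∈ U, f z = w) : {z ∈ closure U | deriv f z = 0}.Finite := by
  by_contra hinf
  obtain ⟨w, hw, hacc⟩ := Set.Infinite.exists_accPt_of_subset_isCompact hinf
    hbdd.isCompact_closure (sep_subset _ _)
  have hfr : ∃ᶠ z in 𝓝[≠] w, deriv f z = 0 := (accPt_iff_frequently_nhdsNE.1 hacc).mono fun z hz => hz.2
  have h0 := hf.deriv.eqOn_zero_of_preconnected_of_frequently_eq_zero hc.closure hw hfr
  refine hnc ?_
  rcases U.eq_empty_or_nonempty with rfl | ⟨z₀, hz₀⟩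
  · simp
  refine ⟨f z₀, fun z hz => hU.is_const_of_deriv_eq_zero hc
    (fun z hz => (hf z (subset_closure hz)).differentiableAt.differentiableWithinAt)
    (fun z hz => h0 (subset_closure hz)) hz hz₀⟩

open Metric Set in
/-- A bounded domain attracted to a fixed point under a map holomorphic on its closure that
preserves the boundary has a fixed point on its boundary. -/
theorem exists_fixedPoint_mem_closure_diff {U : Set ℂ} {f : ℂ → ℂ} {ζ : ℂ} (hU : IsOpen U)
    (hc : IsPreconnected U) (hbdd : Bornology.IsBounded U) (hf : AnalyticOnNhd ℂ f (closure U))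
    (hmaps : MapsTo f U U) (hbd : ∀ z ∈ closure U, f z ∈ U → z ∈ U)
    (hζ : ζ ∈ U) (hfix : f ζ = ζ)
    (hconv : TendstoLocallyUniformlyOn (fun n => f^[n]) (fun _ => ζ) atTop U) :
    ∃ w ∈ closure U \ U, f w = w := by
  have hnc : ¬ ∃ w, ∀ z ∈ U, f z = w := by
    -- A constant value would be ζ, taken on the closure too, making U clopen.
    rintro ⟨w, hw⟩
    obtain rfl : ζ = w := by rw [← hw ζ hζ, hfix]
    have hcl : IsClosed U := by
      refine isClosed_of_closure_subset fun z hz => hbd z hz ?_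
      have : EqOn f (fun _ => ζ) (closure U) :=
        (show EqOn f (fun _ => ζ) U from hw).of_subset_closure hf.continuousOn continuousOn_const
          subset_closure Subset.rfl
      rw [this hz]; exact hζ
    have huniv : U = univ := IsClopen.eq_univ ⟨hcl, hU⟩ ⟨ζ, hζ⟩
    rw [huniv] at hbdd
    exact NormedSpace.unbounded_univ ℝ ℂ hbdd
  have himg := image_eq_of_forall_mem_closure hU hc ⟨ζ, hζ⟩ hbdd hf hmaps hbd hnc
  let E := {z ∈ closure U | deriv f z = 0} ∩ U
  have hE : E.Finite := (finite_setOf_deriv_eq_zero hU hc hbdd hf hnc).inter_of_left U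
  -- Countable, so that removing it does not disconnect U; closed, because critical orbits converge
  -- to ζ. The inner ζ compactifies each orbit, and the outer one covers the case without critical
  -- points.
  let P : Set ℂ := insert ζ (⋃ c ∈ E, insert ζ (range fun n => f^[n] c))
  have hPc : P.Countable :=
    (hE.countable.biUnion fun c _ => (countable_range _).insert ζ).insert ζ
  have hPcl : IsClosed P := by
    refine IsCompact.isClosed (IsCompact.insert (hE.isCompact_biUnion fun c hc => ?_) ζ)
    exact (hconv.tendsto_at hc.2).isCompact_insert_range
  have hPf : ∀ z ∈ P, f z ∈ P := by
    intro z hz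
    simp only [P, mem_insert_iff, mem_iUnion, mem_range] at hz ⊢
    rcases hz with rfl | ⟨c, hc, rfl | ⟨n, rfl⟩⟩
    · exact Or.inl hfix
    · exact Or.inl hfix
    · exact Or.inr ⟨c, hc, Or.inr ⟨n + 1, Function.iterate_succ_apply' f n c⟩⟩
  have hEP : ∀ z ∈ U, deriv f z = 0 → z ∈ P := by
    intro z hz hd
    simp only [P, mem_insert_iff, mem_iUnion, mem_range]
    exact Or.inr ⟨z, ⟨⟨subset_closure hz, hd⟩, hz⟩, Or.inr ⟨0, rfl⟩⟩
  have hζP : ζ ∈ P := mem_insert _ _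
  let V := U \ P
  have hVo : IsOpen V := hU.sdiff hPcl
  have hback : ∀ z ∈ U, f z ∈ V → z ∈ V := fun z hz hfz => ⟨hz, fun h => hfz.2 (hPf z h)⟩
  have hcovV : ∀ z ∈ closure U, f z ∈ V → z ∈ U ∧ AnalyticAt ℂ f z ∧ deriv f z ≠ 0 :=
    fun z hz hfz => ⟨hbd z hz hfz.1, hf z hz,
      fun h => (hback z (hbd z hz hfz.1) hfz).2 (hEP z (hbd z hz hfz.1) h)⟩
  obtain ⟨z₀, hz₀⟩ : ∃ z, z ∈ V := (hPc.dense_compl ℝ).inter_open_nonempty U hU ⟨ζ, hζ⟩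
  obtain ⟨z₁, hz₁U, hz₁⟩ : z₀ ∈ f '' U := himg.symm ▸ hz₀.1
  have hz₁V : z₁ ∈ V := hback z₁ hz₁U (hz₁ ▸ hz₀)
  obtain ⟨p, hp0, hp1, hpV⟩ := (hc.joinedIn_diff_countable hU hPc hz₀ hz₁V).exists_polynomial hVo
  let K : Set ℂ := (fun t : ℝ => (t : ℂ)) '' Icc 0 1
  have hK : IsCompact K := isCompact_Icc.image Complex.continuous_ofReal
  have hKc : Convex ℝ K := (convex_Icc (0 : ℝ) 1).linear_image Complex.ofRealCLM.toLinearMap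
  have h0K : (0 : ℂ) ∈ K := ⟨0, by simp, by simp⟩
  have h1K : (1 : ℂ) ∈ K := ⟨1, by simp, by simp⟩
  have hpK : ∀ s ∈ K, p.eval s ∈ V := by
    rintro _ ⟨t, ht, rfl⟩
    exact hpV t ht
  obtain ⟨δ, hδ, hthick⟩ := hK.exists_thickening_subset_open (hVo.preimage p.continuous) hpK
  let S := thickening δ K
  have hS : IsOpen S := isOpen_thickening
  have hSc : Convex ℝ S := hKc.thickening δ
  have hKS : K ⊆ S := self_subset_thickening hδ K
  have hKS' : ∀ s ∈ K, ball s δ ⊆ S := fun s hs => ball_subset_thickening hs δ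
  -- The condition f(φ 1) = φ 0 lets the lift start at φ 1, and the lift φ' inherits it: f(φ' 1) = φ
  -- 1 = φ' 0.
  let T := {φ : ℂ → ℂ // DifferentiableOn ℂ φ S ∧ MapsTo φ S V ∧ f (φ 1) = φ 0}
  have hstep : ∀ φ : T, ∃ φ' : T, φ'.1 0 = φ.1 1 ∧ ∀ s ∈ S, f (φ'.1 s) = φ.1 s := by
    rintro ⟨φ, hd, hm, he⟩
    obtain ⟨φ', hd', hm', he', hl⟩ := exists_holomorphic_lift hbdd.isCompact_closure hU
      subset_closure hf.continuousOn hcovV hS hSc hd hm (hKS h0K)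
      (subset_closure (hm (hKS h1K)).1) he
    refine ⟨⟨φ', hd', fun s hs => hback _ (hm' hs) ?_, ?_⟩, he', hl⟩
    · rw [hl s hs]; exact hm hs
    · rw [hl 1 (hKS h1K), he']
  choose next hnext0 hnextl using hstep
  let Ψ : ℕ → T := fun n => Nat.rec
    ⟨fun s => p.eval s, p.differentiable.differentiableOn, fun s hs => hthick hs,
      by simp only [hp0, hp1, hz₁]⟩ (fun _ φ => next φ) n
  let Φ : ℕ → ℂ → ℂ := fun n => (Ψ n).1
  have hΦd : ∀ n, DifferentiableOn ℂ (Φ n) S := fun n => (Ψ n).2.1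
  have hΦm : ∀ n, MapsTo (Φ n) S U := fun n s hs => ((Ψ n).2.2.1 hs).1
  have hΦe : ∀ n, f (Φ n 1) = Φ n 0 := fun n => (Ψ n).2.2.2
  have hΦl : ∀ n, ∀ s ∈ S, f (Φ (n + 1) s) = Φ n s := fun n => hnextl (Ψ n)
  have hinv : ∀ n, ∀ s ∈ S, f^[n] (Φ n s) = Φ 0 s := by
    intro n
    induction n with
    | zero => exact fun _ _ => rfl
    | succ n ih =>
      intro s hs
      rw [Function.iterate_succ_apply, hΦl n s hs, ih s hs]
  have hζK : ζ ∉ Φ 0 '' K := by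
    rintro ⟨s, hs, hsζ⟩
    have : Φ 0 s ∈ V := (Ψ 0).2.2.1 (hKS hs)
    exact this.2 (hsζ ▸ hζP)
  have hdiff : Tendsto (fun n => ‖Φ n 0 - Φ n 1‖) atTop (𝓝 0) := by
    rw [Metric.tendsto_atTop']
    intro ε hε
    obtain ⟨N, hN⟩ := eventually_atTop.1 (eventually_norm_deriv_inverse_branch_lt hU hbdd hconv hδ
      hK hKS' hΦd hΦm hinv hζK (half_pos hε))
    refine ⟨N, fun n hn => ?_⟩
    have := hKc.norm_image_sub_le_of_norm_deriv_le (f := Φ n) (C := ε / 2)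
      (fun s hs => (hΦd n).differentiableAt (hS.mem_nhds (hKS hs)))
      (fun s hs => (hN n hn.le s hs).le) h1K h0K
    simp only [dist_zero_right, norm_norm]
    simp at this
    linarith
  obtain ⟨w, hw, l, hl, hlim⟩ := hbdd.isCompact_closure.tendsto_subseq
    (x := fun n => Φ n 1) fun n => subset_closure (hΦm n (hKS h1K))
  have hlim0 : Tendsto (fun n => Φ (l n) 0) atTop (𝓝 w) := by
    have h1 := tendsto_zero_iff_norm_tendsto_zero.2 (hdiff.comp hl.tendsto_atTop)
    simpa using h1.add hlim
  have hlimf : Tendsto (fun n => Φ (l n) 0) atTop (𝓝 (f w)) := by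
    have := (hf w hw).continuousAt.tendsto.comp hlim
    refine this.congr fun n => ?_
    simp [hΦe]
  -- Were w in U, the iterates near it would tend to ζ, yet they carry `Φ n 1` back to `Φ 0 '' K`.
  refine ⟨w, ⟨hw, fun hwU => ?_⟩, tendsto_nhds_unique hlimf hlim0⟩
  have hKcl : IsClosed (Φ 0 '' K) := (hK.image_of_continuousOn ((hΦd 0).continuousOn.mono hKS)).isClosed
  obtain ⟨r, hr, hev⟩ := exists_ball_eventually_notMem_of_iterate hU hconv hKcl hζK hwU
  obtain ⟨n, hn, hn'⟩ := ((hlim.eventually (ball_mem_nhds w hr)).and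
    (hl.tendsto_atTop.eventually hev)).exists
  refine hn' _ hn ?_
  simp only [Function.comp_apply]
  rw [hinv _ _ (hKS h1K)]
  exact mem_image_of_mem _ h1K

/-! ### Local behaviour of Newton's map -/

/-- The Newton map as a function on the plane; its values at the poles are irrelevant. -/
noncomputable def newtonMap (g : ℂ → ℂ) (z : ℂ) : ℂ := z - g z / deriv g z

/-- The points that are not poles of the Newton map. -/
def newtonDomain (g : ℂ → ℂ) : Set ℂ := {z | g z = 0 ∨ deriv g z ≠ 0}

theorem newtonMap_of_eq_zero {g : ℂ → ℂ} {z : ℂ} (h : g z = 0) : newtonMap g z = z := by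
  simp [newtonMap, h]

theorem sphereNewtonMap_eq_coe_iff {g : ℂ → ℂ} {z w : ℂ} :
    sphereNewtonMap g z = (w : OnePoint ℂ) ↔ z ∈ newtonDomain g ∧ newtonMap g z = w := by
  unfold sphereNewtonMap newtonDomain newtonMap
  by_cases h : g z = 0
  · simp [h]
  · by_cases h' : deriv g z = 0
    · simp [h, h']
    · simp [h, h']

theorem IsNewtonInput.differentiable {g : ℂ → ℂ} (hg : IsNewtonInput g) : Differentiable ℂ g := by
  rcases hg with ⟨p, -, hp⟩ | ⟨h, -⟩
  · rw [show g = fun z => p.eval z from funext hp]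
    exact p.differentiable
  · exact h

/-- Every zero of g therefore has finite order. -/
theorem IsNewtonInput.not_eventually_eq_zero {g : ℂ → ℂ} (hg : IsNewtonInput g) (a : ℂ) :
    ¬ ∀ᶠ z in 𝓝 a, g z = 0 := by
  intro h
  have h0 : g = 0 := AnalyticOnNhd.eq_of_eventuallyEq
    (fun z _ => hg.differentiable.analyticAt z) (fun _ _ => analyticAt_const) h
  rcases hg with ⟨p, hp2, hp⟩ | ⟨-, h'⟩
  · have : p = 0 := Polynomial.funext fun z => by rw [← hp z, h0]; simp
    simp [this] at hp2
  · subst h0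
    exact h' (MeromorphicAt.const 0 0)

/-- At a zero of order m, writing g = (z - a)^m h shows that the singularity is removable and the
multiplier is 1 - 1/m. Every root is thus attracting. -/
theorem newtonMap_at_zero {g : ℂ → ℂ} {a : ℂ} (hg : AnalyticAt ℂ g a)
    (hne : ¬ ∀ᶠ z in 𝓝 a, g z = 0) (ha : g a = 0) :
    newtonDomain g ∈ 𝓝 a ∧ AnalyticAt ℂ (newtonMap g) a ∧ ‖deriv (newtonMap g) a‖ < 1 := by
  obtain ⟨m, h, hh, hha, hgh⟩ := hg.exists_eventuallyEq_pow_smul_nonzero_iff.2 hne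
  obtain ⟨n, rfl⟩ : ∃ n, m = n + 1 := by
    refine Nat.exists_eq_succ_of_ne_zero ?_
    rintro rfl
    have := hgh.self_of_nhds
    simp [ha] at this
    exact hha this.symm
  let k : ℂ → ℂ := fun z => (n + 1) * h z + (z - a) * deriv h z
  have hn : (n + 1 : ℂ) ≠ 0 := by exact_mod_cast n.succ_ne_zero
  have hka : k a = (n + 1) * h a := by simp [k]
  have hk0 : k a ≠ 0 := by rw [hka]; exact mul_ne_zero hn hha
  have hk : AnalyticAt ℂ k a := by
    have := hh.deriv
    fun_prop
  have hgd : ∀ᶠ z in 𝓝 a, deriv g z = (z - a) ^ n * k z := by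
    filter_upwards [hgh.eventually_nhds, hh.eventually_analyticAt] with z hz hhz
    have h1 : HasDerivAt (fun w => (w - a) ^ (n + 1) * h w)
        ((((n + 1 : ℕ) : ℂ) * (z - a) ^ n * 1) * h z + (z - a) ^ (n + 1) * deriv h z) z := by
      have := (((hasDerivAt_id z).sub_const a).pow (n + 1)).mul hhz.differentiableAt.hasDerivAt
      simpa using! this
    have h2 : g =ᶠ[𝓝 z] fun w => (w - a) ^ (n + 1) * h w := hz
    rw [h2.deriv_eq, h1.deriv]
    simp only [k]
    push_cast
    ring
  have hkne := hk.continuousAt.eventually_ne hk0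
  let q : ℂ → ℂ := fun z => z - (z - a) * (h z / k z)
  have hq : newtonMap g =ᶠ[𝓝 a] q := by
    filter_upwards [hgh, hgd, hkne] with z hz hdz hkz
    by_cases hza : z = a
    · subst hza
      simp [newtonMap, q, ha]
    · have : z - a ≠ 0 := sub_ne_zero.2 hza
      simp only [newtonMap, q, hz, hdz, smul_eq_mul]
      field_simp
      ring
  have hhk : AnalyticAt ℂ (fun z => h z / k z) a := hh.div hk hk0
  refine ⟨?_, ?_, ?_⟩
  · filter_upwards [hgd, hkne] with z hdz hkz
    by_cases hza : z = a
    · subst hza; exact Or.inl ha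
    · refine Or.inr ?_
      rw [hdz]
      exact mul_ne_zero (pow_ne_zero _ (sub_ne_zero.2 hza)) hkz
  · exact (show AnalyticAt ℂ q a by fun_prop).congr hq.symm
  · have hqd : HasDerivAt q (1 - (1 * (h a / k a) + (a - a) * deriv (fun z => h z / k z) a)) a :=
      (hasDerivAt_id a).sub (((hasDerivAt_id a).sub_const a).mul hhk.differentiableAt.hasDerivAt)
    rw [hq.deriv_eq, hqd.deriv, hka]
    have : (1 - (1 * (h a / ((n + 1) * h a)) + (a - a) * deriv (fun z => h z / k z) a) : ℂ)
        = ((n / (n + 1) : ℝ) : ℂ) := by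
      push_cast
      field_simp
      ring
    rw [this, Complex.norm_real, Real.norm_of_nonneg (by positivity), div_lt_one (by positivity)]
    linarith

theorem IsNewtonInput.newtonMap_analyticAt {g : ℂ → ℂ} (hg : IsNewtonInput g) {z : ℂ}
    (hz : z ∈ newtonDomain g) : newtonDomain g ∈ 𝓝 z ∧ AnalyticAt ℂ (newtonMap g) z := by
  have hgz := hg.differentiable.analyticAt z
  by_cases h0 : g z = 0
  · obtain ⟨h1, h2, -⟩ := newtonMap_at_zero hgz (hg.not_eventually_eq_zero z) h0
    exact ⟨h1, h2⟩
  · have hd : deriv g z ≠ 0 := hz.resolve_left h0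
    refine ⟨(hgz.deriv.continuousAt.eventually_ne hd).mono fun w hw => Or.inr hw, ?_⟩
    exact analyticAt_id.sub (hgz.div hgz.deriv hd)

/-! ### Basins of roots -/

open Metric Set in
/-- A map contracts a small disc about an attracting fixed point linearly. -/
theorem exists_ball_norm_sub_le_of_norm_deriv_lt_one {f : ℂ → ℂ} {ζ : ℂ} {D : Set ℂ}
    (hf : DifferentiableAt ℂ f ζ) (hfix : f ζ = ζ) (hd : ‖deriv f ζ‖ < 1) (hD : D ∈ 𝓝 ζ) :
    ∃ r > 0, ∃ c, 0 ≤ c ∧ c < 1 ∧ ball ζ r ⊆ D ∧ ∀ z ∈ ball ζ r, ‖f z - ζ‖ ≤ c * ‖z - ζ‖ := by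
  obtain ⟨c, hc, hc1⟩ := exists_between hd
  have h1 : ∀ᶠ z in 𝓝 ζ, ‖f z - ζ‖ ≤ c * ‖z - ζ‖ := by
    have h2 := (hasDerivAt_iff_isLittleO.1 hf.hasDerivAt).def (sub_pos.2 hc)
    filter_upwards [h2] with z hz
    rw [hfix, smul_eq_mul] at hz
    have h3 : f z - ζ = (f z - ζ - (z - ζ) * deriv f ζ) + (z - ζ) * deriv f ζ := by ring
    rw [h3]
    refine (norm_add_le _ _).trans ?_
    rw [norm_mul]
    nlinarith
  obtain ⟨r, hr, hsub⟩ := Metric.mem_nhds_iff.1 (inter_mem hD h1)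
  exact ⟨r, hr, c, (norm_nonneg _).trans hc.le, hc1, fun z hz => (hsub hz).1, fun z hz => (hsub hz).2⟩

open Metric Set in
theorem norm_iterate_sub_le {f : ℂ → ℂ} {ζ : ℂ} {r c : ℝ} (hc0 : 0 ≤ c) (hc1 : c < 1)
    (hf : ∀ z ∈ ball ζ r, ‖f z - ζ‖ ≤ c * ‖z - ζ‖) {z : ℂ} (hz : z ∈ ball ζ r) (n : ℕ) :
    f^[n] z ∈ ball ζ r ∧ ‖f^[n] z - ζ‖ ≤ c ^ n * ‖z - ζ‖ := by
  induction n with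
  | zero => simpa using hz
  | succ n ih =>
    have h1 := hf _ ih.1
    have h2 := mem_ball_iff_norm.1 ih.1
    rw [Function.iterate_succ_apply', mem_ball_iff_norm, pow_succ']
    refine ⟨?_, h1.trans ?_⟩
    · nlinarith [norm_nonneg (f^[n] z - ζ)]
    · rw [mul_assoc]
      exact mul_le_mul_of_nonneg_left ih.2 hc0

/-- Plane iterates may replace sphere-valued orbits: staying in `newtonDomain` excludes the junk
values at poles. -/
theorem attractingBasin_sphereNewtonMap (g : ℂ → ℂ) (ζ : ℂ) :
    attractingBasin (sphereNewtonMap g) ζ = {z | (∀ n, (newtonMap g)^[n] z ∈ newtonDomain g) ∧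
      Tendsto (fun n => (newtonMap g)^[n] z) atTop (𝓝 ζ)} := by
  ext z
  constructor
  · rintro ⟨u, hu0, hu, hlim⟩
    have hiter : ∀ n, u n = (newtonMap g)^[n] z := by
      intro n
      induction n with
      | zero => exact hu0
      | succ n ih =>
        rw [Function.iterate_succ_apply', ← ih, (sphereNewtonMap_eq_coe_iff.1 (hu n)).2]
    exact ⟨fun n => hiter n ▸ (sphereNewtonMap_eq_coe_iff.1 (hu n)).1, hlim.congr hiter⟩
  · rintro ⟨h, hlim⟩
    exact ⟨fun n => (newtonMap g)^[n] z, rfl, fun n => sphereNewtonMap_eq_coe_iff.2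
      ⟨h n, (Function.iterate_succ_apply' _ _ _).symm⟩, hlim⟩

open Metric Set in
/-- The basin of a root is open and the Newton iterates converge locally uniformly on it. -/
theorem IsNewtonInput.isOpen_attractingBasin {g : ℂ → ℂ} (hg : IsNewtonInput g) {ζ : ℂ}
    (hζ : g ζ = 0) : IsOpen (attractingBasin (sphereNewtonMap g) ζ) ∧
      TendstoLocallyUniformlyOn (fun n => (newtonMap g)^[n]) (fun _ => ζ) atTop
        (attractingBasin (sphereNewtonMap g) ζ) := by
  obtain ⟨hD, hN, hd⟩ := newtonMap_at_zero (hg.differentiable.analyticAt ζ)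
    (hg.not_eventually_eq_zero ζ) hζ
  obtain ⟨r, hr, c, hc0, hc1, hball, hle⟩ := exists_ball_norm_sub_le_of_norm_deriv_lt_one
    hN.differentiableAt (newtonMap_of_eq_zero hζ) hd hD
  -- Only the first n steps need checking: afterwards the orbit stays in the contracted disc, which
  -- contains no pole.
  have key : ∀ z ∈ attractingBasin (sphereNewtonMap g) ζ, ∃ n, ∀ᶠ y in 𝓝 z,
      (∀ k < n, (newtonMap g)^[k] y ∈ newtonDomain g) ∧ (newtonMap g)^[n] y ∈ ball ζ r := by
    intro z hz
    rw [attractingBasin_sphereNewtonMap] at hz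
    obtain ⟨n, hn⟩ := (hz.2.eventually (ball_mem_nhds ζ hr)).exists
    have hcont : ∀ k, ContinuousAt ((newtonMap g)^[k]) z := by
      intro k
      induction k with
      | zero => exact continuousAt_id
      | succ k ih =>
        rw [Function.iterate_succ']
        exact ContinuousAt.comp (hg.newtonMap_analyticAt (hz.1 k)).2.continuousAt ih
    refine ⟨n, .and ?_ ((hcont n).eventually (isOpen_ball.mem_nhds hn))⟩
    refine (eventually_all_finite (finite_lt_nat n)).2 ?_
    exact fun k _ => (hcont k).eventually (hg.newtonMap_analyticAt (hz.1 k)).1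
  have tail : ∀ n y, (newtonMap g)^[n] y ∈ ball ζ r → ∀ k, (newtonMap g)^[k + n] y ∈ ball ζ r ∧
      ‖(newtonMap g)^[k + n] y - ζ‖ ≤ c ^ k * r := by
    intro n y hy k
    rw [Function.iterate_add_apply]
    obtain ⟨h1, h2⟩ := norm_iterate_sub_le hc0 hc1 hle hy k
    refine ⟨h1, h2.trans ?_⟩
    gcongr
    exact (mem_ball_iff_norm.1 hy).le
  have hpow : Tendsto (fun k => c ^ k * r) atTop (𝓝 0) := by
    simpa using (tendsto_pow_atTop_nhds_zero_of_lt_one hc0 hc1).mul_const r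
  constructor
  · rw [isOpen_iff_mem_nhds]
    intro z hz
    obtain ⟨n, hn⟩ := key z hz
    filter_upwards [hn] with y hy
    rw [attractingBasin_sphereNewtonMap]
    refine ⟨fun k => ?_, ?_⟩
    · by_cases hk : k < n
      · exact hy.1 k hk
      · obtain ⟨j, rfl⟩ := Nat.exists_eq_add_of_le' (not_lt.1 hk)
        exact hball (tail n y hy.2 j).1
    · rw [← tendsto_add_atTop_iff_nat n, tendsto_iff_norm_sub_tendsto_zero]
      exact squeeze_zero (fun _ => norm_nonneg _) (fun k => (tail n y hy.2 k).2) hpow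
  · rw [Metric.tendstoLocallyUniformlyOn_iff]
    intro ε hε z hz
    obtain ⟨n, hn⟩ := key z hz
    refine ⟨_, mem_nhdsWithin_of_mem_nhds hn, ?_⟩
    obtain ⟨N, hN⟩ := eventually_atTop.1 (hpow.eventually (gt_mem_nhds hε))
    filter_upwards [eventually_ge_atTop (N + n)] with m hm y hy
    obtain ⟨j, rfl⟩ := Nat.exists_eq_add_of_le' ((Nat.le_add_left n N).trans hm)
    rw [dist_comm, dist_eq_norm]
    exact (tail n y hy.2 j).2.trans_lt (hN j (by omega))

/-- The finite fixed points of the Newton map are the roots. -/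
theorem eq_zero_of_newtonMap_eq_self {g : ℂ → ℂ} {z : ℂ} (hz : z ∈ newtonDomain g)
    (h : newtonMap g z = z) : g z = 0 := by
  rcases hz with h0 | hd
  · exact h0
  · simpa [newtonMap, hd] using h

/-! ### Unboundedness of the immediate basin -/

open Metric Set in
theorem proposition2p2 (g : ℂ → ℂ) (hg : IsNewtonInput g) (ζ : ℂ)
    (hζ : IsAttractingFixedPoint (sphereNewtonMap g) ζ) :
    ¬ Bornology.IsBounded (immediateBasin (sphereNewtonMap g) ζ) := by
  intro hbdd
  have hroot : g ζ = 0 := by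
    obtain ⟨h, -, hev, hfix, -⟩ := hζ
    have h1 := hev.self_of_nhds
    rw [hfix, sphereNewtonMap_eq_coe_iff] at h1
    exact eq_zero_of_newtonMap_eq_self h1.1 h1.2
  obtain ⟨hAo, hAconv⟩ := hg.isOpen_attractingBasin hroot
  have hAeq := attractingBasin_sphereNewtonMap g ζ
  set A := attractingBasin (sphereNewtonMap g) ζ with hA
  set U := immediateBasin (sphereNewtonMap g) ζ with hU
  have hfix : newtonMap g ζ = ζ := newtonMap_of_eq_zero hroot
  have hζA : ζ ∈ A := by
    rw [hAeq]
    have : ∀ n, (newtonMap g)^[n] ζ = ζ := Function.iterate_fixed hfix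
    simp only [mem_ofPred_eq, this]
    exact ⟨fun _ => Or.inl hroot, tendsto_const_nhds⟩
  have hUA : U ⊆ A := connectedComponentIn_subset A ζ
  have hUo : IsOpen U := hAo.connectedComponentIn
  have hUc : IsPreconnected U := isPreconnected_connectedComponentIn
  have hζU : ζ ∈ U := mem_connectedComponentIn hζA
  have hAdom : ∀ z ∈ A, z ∈ newtonDomain g := fun z hz => by
    rw [hAeq] at hz
    exact hz.1 0
  have hAmaps : ∀ z ∈ A, newtonMap g z ∈ A := fun z hz => by
    rw [hAeq] at hz ⊢
    refine ⟨fun n => ?_, ?_⟩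
    · rw [← Function.iterate_succ_apply]; exact hz.1 (n + 1)
    · simpa only [← Function.iterate_succ_apply] using (tendsto_add_atTop_iff_nat 1).2 hz.2
  have hAback : ∀ z ∈ newtonDomain g, newtonMap g z ∈ A → z ∈ A := fun z hzd hz => by
    rw [hAeq] at hz ⊢
    refine ⟨fun n => ?_, ?_⟩
    · cases n with
      | zero => exact hzd
      | succ n => rw [Function.iterate_succ_apply]; exact hz.1 n
    · rw [← tendsto_add_atTop_iff_nat 1]
      simpa only [Function.iterate_succ_apply] using hz.2
  have hmaps : MapsTo (newtonMap g) U U := by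
    have hcont : ContinuousOn (newtonMap g) U := fun z hz =>
      (hg.newtonMap_analyticAt (hAdom z (hUA hz))).2.continuousAt.continuousWithinAt
    refine mapsTo_iff_image_subset.2 ((hUc.image _ hcont).subset_connectedComponentIn
      ⟨ζ, hζU, hfix⟩ (image_subset_iff.2 fun z hz => hAmaps z (hUA hz)))
  -- The inequality |g| ≤ 2M|g'| is a closed condition, and it forces g = 0 wherever g' = 0.
  have hdom : ∀ z ∈ closure U, z ∈ newtonDomain g := by
    obtain ⟨M, hM, hUM⟩ := hbdd.exists_pos_norm_le
    have hbound : ∀ z ∈ U, ‖g z‖ ≤ 2 * M * ‖deriv g z‖ := by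
      intro z hz
      have e : g z = (z - newtonMap g z) * deriv g z := by
        rcases hAdom z (hUA hz) with h | h
        · simp [newtonMap, h]
        · simp [newtonMap, h]
      rw [e, norm_mul]
      gcongr
      linarith [norm_sub_le z (newtonMap g z), hUM z hz, hUM _ (hmaps hz)]
    intro z hz
    have hcl : IsClosed {z | ‖g z‖ ≤ 2 * M * ‖deriv g z‖} := by
      have h1 := hg.differentiable.continuous
      have h2 : Continuous (deriv g) :=
        continuous_iff_continuousAt.2 fun z => (hg.differentiable.analyticAt z).deriv.continuousAt
      exact isClosed_le (by fun_prop) (by fun_prop)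
    have hz' : ‖g z‖ ≤ 2 * M * ‖deriv g z‖ := closure_minimal hbound hcl hz
    by_cases hd : deriv g z = 0
    · left
      simpa [hd] using hz'
    · exact Or.inr hd
  have hbd : ∀ z ∈ closure U, newtonMap g z ∈ U → z ∈ U := by
    intro z hz hfz
    have hzA : z ∈ A := hAback z (hdom z hz) (hUA hfz)
    -- Adjoining a closure point keeps U connected, so the component already contains z.
    have hc : IsPreconnected (insert z U) := hUc.subset_closure (subset_insert z U)
      (insert_subset hz subset_closure)
    exact hc.subset_connectedComponentIn (mem_insert_of_mem z hζU) (insert_subset hzA hUA)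
      (mem_insert z U)
  obtain ⟨w, ⟨hw, hwU⟩, hwfix⟩ := exists_fixedPoint_mem_closure_diff hUo hUc hbdd
    (fun z hz => (hg.newtonMap_analyticAt (hdom z hz)).2) hmaps hbd hζU hfix (hAconv.mono hUA)
  have hw0 := eq_zero_of_newtonMap_eq_self (hdom w hw) hwfix
  have hwB : w ∈ attractingBasin (sphereNewtonMap g) w := by
    rw [attractingBasin_sphereNewtonMap]
    have : ∀ n, (newtonMap g)^[n] w = w := Function.iterate_fixed hwfix
    simp only [mem_ofPred_eq, this]
    exact ⟨fun _ => Or.inl hw0, tendsto_const_nhds⟩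
  obtain ⟨y, hyB, hyU⟩ := mem_closure_iff.1 hw _ (hg.isOpen_attractingBasin hw0).1 hwB
  rw [attractingBasin_sphereNewtonMap] at hyB
  have hyA := hUA hyU
  rw [hAeq] at hyA
  exact hwU (tendsto_nhds_unique hyB.2 hyA.2 ▸ hζU)
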